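/- Let $\mathbb{D}=\{z\in\mathbb{C}:|z|<1\}$ be the open unit disk and let $\mathcal{A}$ be the class of analytic functions $f$ on $\mathbb{D}$ with $f(0)=0$ and $f'(0)=1$. A function $f\in\mathcal{A}$ is called convex if it is univalent (that is, injective) on $\mathbb{D}$ and $f(\mathbb{D})$ is a convex domain. Let $\alpha$ be a complex number with $|2\alpha-1|\le 1$, and let $f\in\mathcal{A}$ be convex. Then the function $$z\mapsto \alpha f(z)+(1-\alpha)\,z f'(z)$$ is univalent in $\mathbb{D}$, that is, analytic and injective on $\mathbb{D}$. -/

import Mathlib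

/-- `f` is univalent in `U`: holomorphic and injective on `U`. -/
def IsUnivalentOn (f : ℂ → ℂ) (U : Set ℂ) : Prop :=
  DifferentiableOn ℂ f U ∧ Set.InjOn f U

/-- The class `𝒜`: functions analytic on the open unit disk, normalized by
`f 0 = 0` and `f' 0 = 1`. Values of `f` outside the disk are irrelevant. -/
def ClassA : Set (ℂ → ℂ) :=
  {f | DifferentiableOn ℂ f (Metric.ball (0 : ℂ) 1) ∧ f 0 = 0 ∧ deriv f 0 = 1}

/-- A function (of the class `𝒜`) is convex if it is univalent in the unit disk and maps it onto
a convex domain. The image of a univalent function is automatically open and connected. -/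
def IsConvexFunction (f : ℂ → ℂ) : Prop :=
  IsUnivalentOn f (Metric.ball (0 : ℂ) 1) ∧ Convex ℝ (f '' Metric.ball (0 : ℂ) 1)

/-!
Write `p z = 1 + z f''(z) / f'(z)`. The function `F = α f + (1 - α) z f'` satisfies
`F' = f' (α + (1 - α) p)`, so for `α ≠ 1`
`((1 - α)⁻¹ F)' / f' = α / (1 - α) + p`.
The condition `‖2 α - 1‖ ≤ 1` says exactly that `α / (1 - α)` has nonnegative real part, and convexity
of `f` gives `0 < re p`. Hence `(1 - α)⁻¹ F` is close-to-convex with respect to `f`, and such functions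
are injective: composed with `f⁻¹`, they have a derivative of positive real part on a convex domain
(`injOn_of_re_deriv_div_deriv_pos`).

The inequality `0 < re p` (`IsConvexFunction.re_one_add_mul_deriv_deriv_div_deriv_pos`) is obtained as
follows. For real `s`, convexity of the image makes
`ζ ↦ f⁻¹ ((f (ζ exp (i s)) + f (ζ exp (-i s))) / 2)` a holomorphic self-map of the disk fixing `0`, so
by the Schwarz lemma its value at `z` has norm at most `‖z‖`, with equality at `s = 0`. That value is
`z (1 - s² p z / 2 + o (s²))`, whence `0 ≤ re (p z)`; the maximum principle applied to `exp (-p)`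
excludes equality, because `p 0 = 1`.

Both steps need that the inverse of a univalent function is holomorphic, which follows from the open
mapping theorem and the removability of isolated singularities of continuous functions.
-/

open Set Filter Topology Metric

/-! ### The inverse of a univalent function -/

section Inverse

variable {f : ℂ → ℂ} {U : Set ℂ}

lemma nhds_le_map_nhds_of_injOn (hU : IsOpen U) (hf : DifferentiableOn ℂ f U) (hinj : InjOn f U)
    {z : ℂ} (hz : z ∈ U) : 𝓝 (f z) ≤ map f (𝓝 z) := by
  rcases (hf.analyticAt (hU.mem_nhds hz)).eventually_constant_or_nhds_le_map_nhds with h | h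
  · exfalso
    have h1 : ∀ᶠ w in 𝓝[≠] z, w = z := by
      filter_upwards [nhdsWithin_le_nhds h, nhdsWithin_le_nhds (hU.mem_nhds hz)] with w hw hwU
      exact hinj hwU hz hw
    obtain ⟨w, hw, hne⟩ := (h1.and self_mem_nhdsWithin).exists
    exact hne hw
  · exact h

lemma isOpen_image_of_injOn (hU : IsOpen U) (hf : DifferentiableOn ℂ f U) (hinj : InjOn f U) :
    IsOpen (f '' U) := by
  rw [isOpen_iff_mem_nhds]
  rintro _ ⟨z, hz, rfl⟩
  exact nhds_le_map_nhds_of_injOn hU hf hinj hz (image_mem_map (hU.mem_nhds hz))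

lemma continuousAt_invFunOn (hU : IsOpen U) (hf : DifferentiableOn ℂ f U) (hinj : InjOn f U)
    {z : ℂ} (hz : z ∈ U) : ContinuousAt (Function.invFunOn f U) (f z) := by
  intro V hV
  rw [hinj.leftInvOn_invFunOn hz] at hV
  have h : f '' (V ∩ U) ∈ 𝓝 (f z) :=
    nhds_le_map_nhds_of_injOn hU hf hinj hz (image_mem_map (inter_mem hV (hU.mem_nhds hz)))
  refine mem_map.2 (mem_of_superset h ?_)
  rintro _ ⟨w, ⟨hwV, hwU⟩, rfl⟩
  simpa [hinj.leftInvOn_invFunOn hwU] using hwV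

lemma hasDerivAt_invFunOn_of_deriv_ne_zero (hU : IsOpen U) (hf : DifferentiableOn ℂ f U)
    (hinj : InjOn f U) {z : ℂ} (hz : z ∈ U) (hd : deriv f z ≠ 0) :
    HasDerivAt (Function.invFunOn f U) (deriv f z)⁻¹ (f z) := by
  refine HasDerivAt.of_local_left_inverse (f := f) (continuousAt_invFunOn hU hf hinj hz) ?_ hd ?_
  · rw [hinj.leftInvOn_invFunOn hz]
    exact (hf.differentiableAt (hU.mem_nhds hz)).hasDerivAt
  · filter_upwards [(isOpen_image_of_injOn hU hf hinj).mem_nhds (mem_image_of_mem f hz)] with w hw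
    exact Function.invFunOn_eq hw

lemma eventually_deriv_ne_zero_of_injOn (hU : IsOpen U) (hf : DifferentiableOn ℂ f U)
    (hinj : InjOn f U) {z : ℂ} (hz : z ∈ U) : ∀ᶠ w in 𝓝[≠] z, deriv f w ≠ 0 := by
  rcases (hf.analyticAt (hU.mem_nhds hz)).deriv.eventually_eq_zero_or_eventually_ne_zero with h | h
  · exfalso
    obtain ⟨r, hr, hball⟩ := Metric.mem_nhds_iff.1 (inter_mem h (hU.mem_nhds hz))
    have hconst : ∀ w ∈ ball z r, f w = f z := fun w hw =>
      isOpen_ball.is_const_of_deriv_eq_zero (convex_ball z r).isPreconnected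
        (hf.mono fun x hx => (hball hx).2) (fun x hx => (hball hx).1) hw (mem_ball_self hr)
    have h1 : ∀ᶠ w in 𝓝[≠] z, w = z := by
      filter_upwards [nhdsWithin_le_nhds (ball_mem_nhds z hr)] with w hw
      exact hinj (hball hw).2 hz (hconst w hw)
    obtain ⟨w, hw, hne⟩ := (h1.and self_mem_nhdsWithin).exists
    exact hne hw
  · exact h

/-- The inverse is continuous, and holomorphic away from the isolated critical values, which are
therefore removable singularities. -/
lemma differentiableAt_invFunOn (hU : IsOpen U) (hf : DifferentiableOn ℂ f U) (hinj : InjOn f U)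
    {z : ℂ} (hz : z ∈ U) : DifferentiableAt ℂ (Function.invFunOn f U) (f z) := by
  have hV : {w | w ≠ z → deriv f w ≠ 0} ∩ U ∈ 𝓝 z :=
    inter_mem (eventually_nhdsWithin_iff.1 (eventually_deriv_ne_zero_of_injOn hU hf hinj hz))
      (hU.mem_nhds hz)
  have hfV := nhds_le_map_nhds_of_injOn hU hf hinj hz (image_mem_map hV)
  refine ((Complex.differentiableOn_compl_singleton_and_continuousAt_iff hfV).1
    ⟨?_, continuousAt_invFunOn hU hf hinj hz⟩).differentiableAt hfV
  rintro _ ⟨⟨w, ⟨hw, hwU⟩, rfl⟩, hne⟩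
  have hwz : w ≠ z := fun h => hne (by simp [h])
  exact (hasDerivAt_invFunOn_of_deriv_ne_zero hU hf hinj hwU
    (hw hwz)).differentiableAt.differentiableWithinAt

lemma deriv_ne_zero_of_injOn (hU : IsOpen U) (hf : DifferentiableOn ℂ f U) (hinj : InjOn f U)
    {z : ℂ} (hz : z ∈ U) : deriv f z ≠ 0 := by
  intro h0
  have h1 : HasDerivAt (Function.invFunOn f U ∘ f)
      (deriv (Function.invFunOn f U) (f z) * deriv f z) z :=
    (differentiableAt_invFunOn hU hf hinj hz).hasDerivAt.comp z
      (hf.differentiableAt (hU.mem_nhds hz)).hasDerivAt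
  have h2 : HasDerivAt (Function.invFunOn f U ∘ f) 1 z := by
    refine (hasDerivAt_id z).congr_of_eventuallyEq ?_
    filter_upwards [hU.mem_nhds hz] with w hw
    exact hinj.leftInvOn_invFunOn hw
  have := h1.unique h2
  simp [h0] at this

lemma hasDerivAt_invFunOn (hU : IsOpen U) (hf : DifferentiableOn ℂ f U) (hinj : InjOn f U)
    {z : ℂ} (hz : z ∈ U) : HasDerivAt (Function.invFunOn f U) (deriv f z)⁻¹ (f z) :=
  hasDerivAt_invFunOn_of_deriv_ne_zero hU hf hinj hz (deriv_ne_zero_of_injOn hU hf hinj hz)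

/-! ### Close-to-convex functions are injective -/

/-- The Noshiro–Warschawski criterion, transported to `U` by the univalent function `f`. -/
theorem injOn_of_re_deriv_div_deriv_pos (hU : IsOpen U) (hf : DifferentiableOn ℂ f U)
    (hinj : InjOn f U) (hconv : Convex ℝ (f '' U)) {F : ℂ → ℂ} (hF : DifferentiableOn ℂ F U)
    (hpos : ∀ z ∈ U, 0 < (deriv F z / deriv f z).re) : InjOn F U := by
  intro x hx y hy hxy
  by_contra hne
  have hd : f y - f x ≠ 0 := fun h => hne (hinj hx hy (sub_eq_zero.1 h).symm)
  set h := Function.invFunOn f U with hh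
  -- `γ` is the segment from `f x` to `f y`; `t ↦ re (F (f⁻¹ (γ t)) / (f y - f x))` increases along it.
  let γ : ℝ → ℂ := fun t => f x + t * (f y - f x)
  have hγ : ∀ t ∈ Icc (0 : ℝ) 1, γ t ∈ f '' U := by
    intro t ht
    have := hconv.add_smul_sub_mem (mem_image_of_mem f hx) (mem_image_of_mem f hy) ht
    simpa [γ] using this
  have hder : ∀ t ∈ Icc (0 : ℝ) 1, ∃ z ∈ U,
      HasDerivAt (fun t => (F (h (γ t)) / (f y - f x)).re) (deriv F z / deriv f z).re t := by
    intro t ht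
    obtain ⟨z, hz, hzt⟩ := hγ t ht
    refine ⟨z, hz, ?_⟩
    have h1 : HasDerivAt γ (f y - f x) t := by
      simpa [γ] using ((Complex.ofRealCLM.hasDerivAt (x := t)).mul_const (f y - f x)).const_add (f x)
    have h2 : HasDerivAt h (deriv f z)⁻¹ (γ t) := by
      rw [← hzt]; exact hasDerivAt_invFunOn hU hf hinj hz
    have h3 : HasDerivAt F (deriv F z) (h (γ t)) := by
      rw [← hzt, hh, hinj.leftInvOn_invFunOn hz]
      exact (hF.differentiableAt (hU.mem_nhds hz)).hasDerivAt
    have h4 := ((h3.comp (γ t) h2).comp_of_eq t h1 rfl).div_const (f y - f x)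
    have h5 := Complex.reCLM.hasFDerivAt.comp_hasDerivAt t h4
    refine h5.congr_deriv (congrArg Complex.re ?_)
    field_simp
  have hmono : StrictMonoOn (fun t => (F (h (γ t)) / (f y - f x)).re) (Icc (0 : ℝ) 1) := by
    refine strictMonoOn_of_deriv_pos (convex_Icc 0 1) ?_ ?_
    · intro t ht
      obtain ⟨z, -, hz⟩ := hder t ht
      exact hz.continuousAt.continuousWithinAt
    · intro t ht
      obtain ⟨z, hzU, hz⟩ := hder t (interior_subset ht)
      rw [hz.deriv]
      exact hpos z hzU
  have hlt := hmono (left_mem_Icc.2 zero_le_one) (right_mem_Icc.2 zero_le_one) zero_lt_one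
  have e0 : h (γ 0) = x := by
    rw [show γ 0 = f x by simp [γ]]; exact hinj.leftInvOn_invFunOn hx
  have e1 : h (γ 1) = y := by
    rw [show γ 1 = f y by simp [γ]]; exact hinj.leftInvOn_invFunOn hy
  simp only [e0, e1, hxy] at hlt
  exact lt_irrefl _ hlt

end Inverse

/-! ### The analytic characterization of convexity -/

lemma Convex.add_div_two_mem {s : Set ℂ} (hs : Convex ℝ s) {a b : ℂ} (ha : a ∈ s) (hb : b ∈ s) :
    (a + b) / 2 ∈ s := by
  have := hs ha hb (a := 1 / 2) (b := 1 / 2) (by norm_num) (by norm_num) (by norm_num)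
  simp only [Complex.real_smul] at this
  convert this using 1
  push_cast
  ring

lemma norm_mul_exp_ofReal_mul_I (z : ℂ) (s : ℝ) : ‖z * Complex.exp (s * Complex.I)‖ = ‖z‖ := by
  rw [norm_mul, Complex.norm_exp_ofReal_mul_I, mul_one]

/-- At a local maximum the second derivative is nonpositive. -/
lemma IsLocalMax.deriv_deriv_nonpos {R : ℝ → ℝ} {a : ℝ} (h : IsLocalMax R a)
    (hc : ContinuousAt R a) : deriv (deriv R) a ≤ 0 := by
  by_contra! hpos
  have hmin := isLocalMin_of_deriv_deriv_pos hpos h.deriv_eq_zero hc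
  have hev : R =ᶠ[𝓝 a] fun _ => R a := by
    filter_upwards [h, hmin] with x h1 h2 using le_antisymm h1 h2
  have : deriv (deriv R) a = 0 := by
    rw [hev.deriv.deriv_eq]; simp
  exact hpos.ne' this

section Convex

open Complex (I exp)

variable {f : ℂ → ℂ}

/-- The Schwarz lemma for `ζ ↦ f⁻¹ ((f (ζ exp (i s)) + f (ζ exp (-i s))) / 2)`. -/
lemma IsConvexFunction.norm_invFunOn_midpoint_le (hconv : IsConvexFunction f) (h0 : f 0 = 0)
    {z : ℂ} (hz : z ∈ ball (0 : ℂ) 1) (s : ℝ) :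
    ‖Function.invFunOn f (ball 0 1)
      ((f (z * exp (s * I)) + f (z * exp ((-s : ℝ) * I))) / 2)‖ ≤ ‖z‖ := by
  obtain ⟨⟨hf, hinj⟩, hC⟩ := hconv
  have hrot : ∀ ζ ∈ ball (0 : ℂ) 1, ∀ t : ℝ, ζ * exp (t * I) ∈ ball (0 : ℂ) 1 := by
    intro ζ hζ t
    simpa [norm_mul_exp_ofReal_mul_I] using hζ
  have hmid : ∀ ζ ∈ ball (0 : ℂ) 1,
      (f (ζ * exp (s * I)) + f (ζ * exp ((-s : ℝ) * I))) / 2 ∈ f '' ball (0 : ℂ) 1 := by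
    intro ζ hζ
    exact hC.add_div_two_mem (mem_image_of_mem f (hrot ζ hζ s)) (mem_image_of_mem f (hrot ζ hζ (-s)))
  have hdrot : ∀ t : ℝ, DifferentiableOn ℂ (fun ζ => f (ζ * exp (t * I))) (ball 0 1) := fun t =>
    hf.comp (by fun_prop) (fun ζ hζ => hrot ζ hζ t)
  have hinv : DifferentiableOn ℂ (Function.invFunOn f (ball 0 1)) (f '' ball 0 1) := by
    rintro _ ⟨w, hw, rfl⟩
    exact (differentiableAt_invFunOn isOpen_ball hf hinj hw).differentiableWithinAt
  refine Complex.norm_le_norm_of_mapsTo_ball (R := 1) (f := fun ζ => Function.invFunOn f (ball 0 1)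
      ((f (ζ * exp (s * I)) + f (ζ * exp ((-s : ℝ) * I))) / 2)) ?_ ?_ ?_ (by simpa using hz)
  · exact hinv.comp (((hdrot s).add (hdrot (-s))).div_const 2) hmid
  · intro ζ hζ
    exact Metric.ball_subset_closedBall (Function.invFunOn_mem (hmid ζ hζ))
  · have := hinj.leftInvOn_invFunOn (mem_ball_self (x := (0 : ℂ)) one_pos)
    rw [h0] at this
    simpa [h0] using this

/-- The second derivative in `s` of
`re (conj z * f⁻¹ ((f (z exp (i s)) + f (z exp (-i s))) / 2))`, which is maximal at `s = 0`, equals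
`-‖z‖² re (1 + z f''(z) / f'(z))` there. -/
lemma IsConvexFunction.re_one_add_mul_deriv_deriv_div_deriv_nonneg (hconv : IsConvexFunction f)
    (h0 : f 0 = 0) {z : ℂ} (hz : z ∈ ball (0 : ℂ) 1) :
    0 ≤ (1 + z * deriv (deriv f) z / deriv f z).re := by
  rcases eq_or_ne z 0 with rfl | hz0
  · simp
  have hschwarz := hconv.norm_invFunOn_midpoint_le h0 hz
  obtain ⟨⟨hf, hinj⟩, hC⟩ := hconv
  have hrot : ∀ t : ℝ, z * exp (t * I) ∈ ball (0 : ℂ) 1 := by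
    intro t
    simpa [norm_mul_exp_ofReal_mul_I] using hz
  set h := Function.invFunOn f (ball 0 1) with hh
  let φ : ℝ → ℂ := fun s => (f (z * exp (s * I)) + f (z * exp ((-s : ℝ) * I))) / 2
  let u : ℝ → ℂ := fun s => deriv f (z * exp (s * I)) * (z * (exp (s * I) * I))
  let φ' : ℝ → ℂ := fun s => (u s - u (-s)) / 2
  have hφ0 : φ 0 = f z := by simp [φ]
  have hφ'0 : φ' 0 = 0 := by simp [φ']
  have hφmem : ∀ s, φ s ∈ f '' ball (0 : ℂ) 1 := by
    intro s
    exact hC.add_div_two_mem (mem_image_of_mem f (hrot s)) (mem_image_of_mem f (hrot (-s)))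
  have hrotd : ∀ s : ℝ, HasDerivAt (fun s : ℝ => z * exp (s * I)) (z * (exp (s * I) * I)) s := by
    intro s
    have h1 : HasDerivAt (fun s : ℝ => (s : ℂ) * I) I s := by
      simpa using (Complex.ofRealCLM.hasDerivAt (x := s)).mul_const I
    exact (h1.cexp).const_mul z
  have hfrot : ∀ s : ℝ, HasDerivAt (fun s : ℝ => f (z * exp (s * I))) (u s) s := by
    intro s
    exact (hf.differentiableAt (isOpen_ball.mem_nhds (hrot s))).hasDerivAt.comp s (hrotd s)
  have hφ : ∀ s, HasDerivAt φ (φ' s) s := by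
    intro s
    have h2 := (hfrot (-s)).scomp s (hasDerivAt_neg s)
    refine (((hfrot s).add h2).div_const 2).congr_deriv ?_
    rw [neg_one_smul, ← sub_eq_add_neg]
  have hhd : ∀ w ∈ f '' ball (0 : ℂ) 1, DifferentiableAt ℂ h w := by
    rintro _ ⟨w, hw, rfl⟩
    exact differentiableAt_invFunOn isOpen_ball hf hinj hw
  let R : ℝ → ℝ := fun s => (starRingEnd ℂ z * h (φ s)).re
  have hR : ∀ s, HasDerivAt R (starRingEnd ℂ z * (deriv h (φ s) * φ' s)).re s := by
    intro s
    have h3 := ((hhd _ (hφmem s)).hasDerivAt.comp s (hφ s)).const_mul (starRingEnd ℂ z)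
    exact Complex.reCLM.hasFDerivAt.comp_hasDerivAt s h3
  have hu : HasDerivAt u (-(z ^ 2 * deriv (deriv f) z + z * deriv f z)) 0 := by
    have h4 : HasDerivAt (deriv f) (deriv (deriv f) z) (z * exp ((0 : ℝ) * I)) := by
      simpa using ((hf.deriv isOpen_ball).differentiableAt (isOpen_ball.mem_nhds hz)).hasDerivAt
    have h5 := (h4.comp (0 : ℝ) (hrotd 0)).mul ((hrotd 0).mul_const I)
    have h6 : u = (deriv f ∘ fun s : ℝ => z * exp (s * I)) * fun s : ℝ => z * exp (s * I) * I := by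
      funext s
      simp only [u, Pi.mul_apply, Function.comp, mul_assoc]
    rw [h6]
    refine h5.congr_deriv ?_
    simp only [Function.comp, Complex.ofReal_zero, zero_mul, Complex.exp_zero, mul_one, one_mul]
    linear_combination (z ^ 2 * deriv (deriv f) z + z * deriv f z) * Complex.I_sq
  have hφ'' : HasDerivAt φ' (-(z ^ 2 * deriv (deriv f) z + z * deriv f z)) 0 := by
    have hu' : HasDerivAt u (-(z ^ 2 * deriv (deriv f) z + z * deriv f z)) (-(0 : ℝ)) := by
      simpa using hu
    have h6 := hu'.scomp (0 : ℝ) (hasDerivAt_neg (0 : ℝ))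
    refine ((hu.sub h6).div_const 2).congr_deriv ?_
    rw [neg_one_smul]
    ring
  have hh' : HasDerivAt (deriv h) (deriv (deriv h) (φ 0)) (φ 0) := by
    have hopen := isOpen_image_of_injOn isOpen_ball hf hinj
    have hon : DifferentiableOn ℂ h (f '' ball 0 1) :=
      fun w hw => (hhd w hw).differentiableWithinAt
    exact ((hon.deriv hopen).differentiableAt (hopen.mem_nhds (hφmem 0))).hasDerivAt
  have hR2 : deriv (deriv R) 0 = -(‖z‖ ^ 2 * (1 + z * deriv (deriv f) z / deriv f z).re) := by
    rw [show deriv R = fun s => (starRingEnd ℂ z * (deriv h (φ s) * φ' s)).re from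
      funext fun s => (hR s).deriv]
    have h7 := ((hh'.comp (0 : ℝ) (hφ 0)).mul hφ'').const_mul (starRingEnd ℂ z)
    have h8 := Complex.reCLM.hasFDerivAt.comp_hasDerivAt (0 : ℝ) h7
    have hfz := deriv_ne_zero_of_injOn isOpen_ball hf hinj hz
    refine HasDerivAt.deriv (h8.congr_deriv ?_)
    rw [hφ'0, Function.comp, hφ0, (hasDerivAt_invFunOn isOpen_ball hf hinj hz).deriv,
      ← Complex.re_ofReal_mul, ← Complex.neg_re, Complex.reCLM_apply]
    congr 1
    push_cast
    rw [← Complex.conj_mul']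
    field_simp
    ring
  have hmax : IsLocalMax R 0 := by
    refine Eventually.of_forall fun s => ?_
    have h9 : R 0 = ‖z‖ * ‖z‖ := by
      have : h (φ 0) = z := by rw [hφ0]; exact hinj.leftInvOn_invFunOn hz
      simp only [R, this]
      rw [← sq, Complex.conj_mul']
      norm_cast
    rw [h9]
    calc R s ≤ ‖starRingEnd ℂ z * h (φ s)‖ := Complex.re_le_norm _
      _ = ‖z‖ * ‖h (φ s)‖ := by rw [norm_mul, Complex.norm_conj]
      _ ≤ ‖z‖ * ‖z‖ := mul_le_mul_of_nonneg_left (hschwarz s) (norm_nonneg z)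
  have hle := hmax.deriv_deriv_nonpos (hR 0).continuousAt
  rw [hR2] at hle
  have hzpos : 0 < ‖z‖ ^ 2 := by positivity
  nlinarith

theorem IsConvexFunction.re_one_add_mul_deriv_deriv_div_deriv_pos (hconv : IsConvexFunction f)
    (h0 : f 0 = 0) {z : ℂ} (hz : z ∈ ball (0 : ℂ) 1) :
    0 < (1 + z * deriv (deriv f) z / deriv f z).re := by
  have hnn := fun w (hw : w ∈ ball (0 : ℂ) 1) =>
    hconv.re_one_add_mul_deriv_deriv_div_deriv_nonneg h0 hw
  refine lt_of_le_of_ne (hnn z hz) fun heq => ?_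
  obtain ⟨⟨hf, hinj⟩, -⟩ := hconv
  let q : ℂ → ℂ := fun w => exp (-(1 + w * deriv (deriv f) w / deriv f w))
  have hq : DifferentiableOn ℂ q (ball 0 1) := by
    have h1 := hf.deriv isOpen_ball
    have h2 := h1.deriv isOpen_ball
    have h3 := (differentiableOn_id.mul h2).div h1
      (fun w hw => deriv_ne_zero_of_injOn isOpen_ball hf hinj hw)
    exact (h3.const_add 1).neg.cexp
  have hnorm : ∀ w, ‖q w‖ = Real.exp (-(1 + w * deriv (deriv f) w / deriv f w).re) := by
    intro w
    rw [Complex.norm_exp, Complex.neg_re]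
  have hmax : IsMaxOn (norm ∘ q) (ball 0 1) z := by
    intro w hw
    simp only [Function.comp, mem_ofPred_eq, hnorm]
    rw [← heq]
    exact Real.exp_le_exp.2 (neg_le_neg (hnn w hw))
  have := Complex.norm_eqOn_of_isPreconnected_of_isMaxOn (convex_ball (0 : ℂ) 1).isPreconnected
    isOpen_ball hq hz hmax (mem_ball_self one_pos)
  simp only [Function.comp, Function.const_apply, hnorm] at this
  rw [← heq] at this
  simp at this

end Convex

/-! ### Univalence of the combination -/

lemma re_div_one_sub_nonneg {α : ℂ} (hα : ‖2 * α - 1‖ ≤ 1) : 0 ≤ (α / (1 - α)).re := by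
  have h := mul_self_le_mul_self (norm_nonneg _) hα
  rw [Complex.norm_mul_self_eq_normSq, Complex.normSq_apply] at h
  simp at h
  rw [Complex.div_re, ← add_div]
  refine div_nonneg ?_ (Complex.normSq_nonneg _)
  simp
  nlinarith

theorem mainTheorem5 (α : ℂ) (hα : ‖2 * α - 1‖ ≤ 1) (f : ℂ → ℂ) (hf : f ∈ ClassA)
    (hconv : IsConvexFunction f) :
    IsUnivalentOn (fun z : ℂ => α * f z + (1 - α) * (z * deriv f z)) (Metric.ball (0 : ℂ) 1) := by
  obtain ⟨hd, h0, -⟩ := hf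
  have hinj := hconv.1.2
  have hd' := hd.deriv isOpen_ball
  have hF : DifferentiableOn ℂ (fun z : ℂ => α * f z + (1 - α) * (z * deriv f z)) (ball 0 1) :=
    (hd.const_mul α).add ((differentiableOn_id.mul hd').const_mul (1 - α))
  refine ⟨hF, ?_⟩
  rcases eq_or_ne α 1 with rfl | hα1
  · simpa using hinj
  have hα1' : 1 - α ≠ 0 := sub_ne_zero.2 hα1.symm
  have key : InjOn (fun z : ℂ => (α * f z + (1 - α) * (z * deriv f z)) / (1 - α)) (ball 0 1) := by
    refine injOn_of_re_deriv_div_deriv_pos isOpen_ball hd hinj hconv.2 (hF.div_const _) ?_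
    intro z hz
    have hfz := deriv_ne_zero_of_injOn isOpen_ball hd hinj hz
    have h1 := (hd.differentiableAt (isOpen_ball.mem_nhds hz)).hasDerivAt
    have h2 := (hd'.differentiableAt (isOpen_ball.mem_nhds hz)).hasDerivAt
    have h3 := ((h1.const_mul α).add (((hasDerivAt_id z).mul h2).const_mul (1 - α))).div_const (1 - α)
    have h4 : deriv (fun z : ℂ => (α * f z + (1 - α) * (z * deriv f z)) / (1 - α)) z / deriv f z
        = α / (1 - α) + (1 + z * deriv (deriv f) z / deriv f z) := by
      rw [HasDerivAt.deriv (f := fun z : ℂ => (α * f z + (1 - α) * (z * deriv f z)) / (1 - α)) h3]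
      simp only [id]
      field_simp
    rw [h4, Complex.add_re]
    exact add_pos_of_nonneg_of_pos (re_div_one_sub_nonneg hα)
      (hconv.re_one_add_mul_deriv_deriv_div_deriv_pos h0 hz)
  intro x hx y hy hxy
  refine key hx hy ?_
  simp only at hxy ⊢
  rw [hxy]
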